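/- Manifolds are smooth and second countable, and all maps are smooth. Let $G$ be a Lie groupoid with base $M$, source map $\alpha$ and target map $\beta$, where $g_2g_1$ is defined when $\alpha(g_2)=\beta(g_1)$. Its group of bisections $\mathcal B(G)$ consists of the smooth maps $b\colon M\to G$ with $\alpha\circ b=\mathrm{id}_M$ and $\beta\circ b$ a diffeomorphism of $M$, under $(b_1\cdot b_2)(m)=b_1\big((\beta\circ b_2)(m)\big)\,b_2(m)$. Let $\varphi\colon F\to M$ be a fibered manifold (a surjective submersion) with an action $S$ of $G$: each $g\in G$ gives a bijection $S(g)\colon\varphi^{-1}(\alpha(g))\to\varphi^{-1}(\beta(g))$, with $S(g_2g_1)=S(g_2)\circ S(g_1)$ whenever $\alpha(g_2)=\beta(g_1)$, and $(g,p)\mapsto S(g)(p)$ is smooth on $\varphi^*G=\{(g,p)\in G\times F:\alpha(g)=\varphi(p)\}$. Let $G\ltimes F$ be the action groupoid, with base $F$: its arrows are the elements $(g,p)\in\varphi^*G$, with source $p$, target $S(g)(p)$ and product $(g_2,S(g_1)(p))\,(g_1,p)=(g_2g_1,p)$. Let $E\to F$ be a smooth real vector bundle of finite rank, let $\Phi(E)$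 be the Lie groupoid of all linear isomorphisms between fibers of $E$, and let $\rho\colon G\ltimes F\to\Phi(E)$ be a representation, that is, a base-preserving morphism of Lie groupoids. So $\rho(g,p)$ is a linear isomorphism $E_p\to E_{S(g)(p)}$. A semi-linear isomorphism of the space $\Gamma E$ of smooth sections is an $\mathbb R$-linear automorphism $\mu$ of $\Gamma E$ for which there is an $\mathbb R$-linear automorphism $\mu^F$ of $C^\infty(F)$ with $\mu(f\psi)=\mu^F(f)\,\mu(\psi)$ for all $f\in C^\infty(F)$ and $\psi\in\Gamma E$. Then there is a group homomorphism $R$ from $\mathcal B(G)$ to the group of semi-linear isomorphisms of $\Gamma E$ that is associated to the given action and to $\rho$ in the following sense. For every $b\in\mathcal B(G)$, the map $b_F\colon p\mapsto S(b(\varphi(p)))(p)$ is a diffeomorphism of $F$; the map $\nu_b$ given by $\nu_b(v)=\rho(b(\varphi(p)),p)(v)$ for $v\in E_p$ is an automorphism of the vector bundle $E$ over $b_F$; and, for all $\psi\in\Gamma E$ and $f\in C^\infty(F)$, $$R(b)\psi=\nu_b\circ\psi\circ b_F^{-1},\qquad R(b)(f\psi)=(f\circ b_F^{-1})\,R(b)\psi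 .$$ -/

import Mathlib

open scoped Manifold ContDiff
open Bundle

noncomputable section

/-! ### Smooth maps on subsets of manifolds -/

section Subsets

variable {HX : Type*} [TopologicalSpace HX] {EX : Type*} [NormedAddCommGroup EX] [NormedSpace ℝ EX]
  {HN : Type*} [TopologicalSpace HN] {EN : Type*} [NormedAddCommGroup EN] [NormedSpace ℝ EN]
  {X : Type*} [TopologicalSpace X] [ChartedSpace HX X]
  {N : Type*} [TopologicalSpace N] [ChartedSpace HN N]

/-- A map `f`, defined on a subset `s` of a manifold `X`, is smooth if it extends to a smooth map on
a neighbourhood in `X` of each point of `s`. When `s` is an embedded submanifold of `X` this is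
smoothness for the submanifold structure. It is used here for the fibre products `G ×_M G` and
`φ^*G = G ×_M F`, which are embedded submanifolds of `G × G` and `G × F` because they are fibre
products along submersions. -/
def SmoothOnSubset (I : ModelWithCorners ℝ EX HX) (J : ModelWithCorners ℝ EN HN)
    (s : Set X) (f : s → N) : Prop :=
  ∀ x : s, ∃ U : Set X, IsOpen U ∧ (x : X) ∈ U ∧ ∃ g : X → N,
    ContMDiffOn I J ∞ g U ∧ ∀ (y : X) (hy : y ∈ s), y ∈ U → g y = f ⟨y, hy⟩

theorem SmoothOnSubset.comp_contMDiff {HY : Type*} [TopologicalSpace HY] {EY : Type*}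
    [NormedAddCommGroup EY] [NormedSpace ℝ EY] {Y : Type*} [TopologicalSpace Y] [ChartedSpace HY Y]
    {I : ModelWithCorners ℝ EX HX} {J : ModelWithCorners ℝ EN HN} {K : ModelWithCorners ℝ EY HY}
    {s : Set X} {f : s → N} (hf : SmoothOnSubset I J s f) {h : Y → X}
    (hh : ContMDiff K I ∞ h) (hs : ∀ y, h y ∈ s) :
    ContMDiff K J ∞ (fun y => f ⟨h y, hs y⟩) := by
  intro y
  obtain ⟨U, hU, hyU, g, hg, hgf⟩ := hf ⟨h y, hs y⟩
  have h1 : ContMDiffAt K J ∞ (fun y => g (h y)) y :=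
    (hg.contMDiffAt (hU.mem_nhds hyU)).comp y hh.contMDiffAt
  refine h1.congr_of_eventuallyEq ?_
  filter_upwards [hh.continuous.continuousAt.preimage_mem_nhds (hU.mem_nhds hyU)] with z hz
  exact (hgf _ (hs z) hz).symm

end Subsets

/-! ### Groupoids, Lie groupoids, bisections -/

/-- A groupoid with set of arrows `A` and set of objects `B`. The product `comp g₂ g₁` is defined
when the source of `g₂` is the target of `g₁`. -/
structure GroupoidOver (A B : Type*) where
  src : A → B
  tgt : A → B
  unit : B → A
  inv : A → A
  comp : ∀ g₂ g₁ : A, src g₂ = tgt g₁ → A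
  src_comp : ∀ g₂ g₁ h, src (comp g₂ g₁ h) = src g₁
  tgt_comp : ∀ g₂ g₁ h, tgt (comp g₂ g₁ h) = tgt g₂
  src_unit : ∀ m, src (unit m) = m
  tgt_unit : ∀ m, tgt (unit m) = m
  src_inv : ∀ g, src (inv g) = tgt g
  tgt_inv : ∀ g, tgt (inv g) = src g
  comp_assoc : ∀ g₃ g₂ g₁ (h : src g₃ = tgt g₂) (h' : src g₂ = tgt g₁),
    comp (comp g₃ g₂ h) g₁ ((src_comp g₃ g₂ h).trans h') =
      comp g₃ (comp g₂ g₁ h') (h.trans (tgt_comp g₂ g₁ h').symm)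
  unit_comp : ∀ g, comp (unit (tgt g)) g (src_unit _) = g
  comp_unit : ∀ g, comp g (unit (src g)) (tgt_unit _).symm = g
  inv_comp : ∀ g, comp (inv g) g (src_inv g) = unit (src g)
  comp_inv : ∀ g, comp g (inv g) (tgt_inv g).symm = unit (tgt g)

namespace GroupoidOver

variable {A B : Type*} (𝒢 : GroupoidOver A B)

theorem comp_congr {a a' b b' : A} (ha : a = a') (hb : b = b') (h : 𝒢.src a = 𝒢.tgt b) :
    𝒢.comp a b h = 𝒢.comp a' b' (by rw [← ha, ← hb]; exact h) := by
  subst ha hb; rfl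

end GroupoidOver

/-- A base-preserving morphism of groupoids. -/
structure GroupoidOver.Hom {A A' B : Type*} (𝒢 : GroupoidOver A B) (ℋ : GroupoidOver A' B) where
  toFun : A → A'
  src_toFun : ∀ g, ℋ.src (toFun g) = 𝒢.src g
  tgt_toFun : ∀ g, ℋ.tgt (toFun g) = 𝒢.tgt g
  toFun_comp : ∀ g₂ g₁ (h : 𝒢.src g₂ = 𝒢.tgt g₁), toFun (𝒢.comp g₂ g₁ h) =
    ℋ.comp (toFun g₂) (toFun g₁) ((src_toFun g₂).trans (h.trans (tgt_toFun g₁).symm))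

section Lie

variable (EG EM : Type*) [NormedAddCommGroup EG] [NormedSpace ℝ EG]
  [NormedAddCommGroup EM] [NormedSpace ℝ EM]
  (G M : Type*) [TopologicalSpace G] [ChartedSpace EG G] [TopologicalSpace M] [ChartedSpace EM M]

/-- A Lie groupoid: arrows and objects are manifolds, source and target are submersions (they are
onto because of the units), and all structure maps are smooth. -/
structure LieGroupoid extends GroupoidOver G M where
  submersion_src : Manifold.IsSubmersion 𝓘(ℝ, EG) 𝓘(ℝ, EM) ∞ src
  submersion_tgt : Manifold.IsSubmersion 𝓘(ℝ, EG) 𝓘(ℝ, EM) ∞ tgt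
  smooth_unit : ContMDiff 𝓘(ℝ, EM) 𝓘(ℝ, EG) ∞ unit
  smooth_inv : ContMDiff 𝓘(ℝ, EG) 𝓘(ℝ, EG) ∞ inv
  smooth_comp : SmoothOnSubset (𝓘(ℝ, EG).prod 𝓘(ℝ, EG)) 𝓘(ℝ, EG)
    {x : G × G | src x.1 = tgt x.2} (fun x => comp x.1.1 x.1.2 x.2)

variable {EG EM G M}

/-- A bisection: a smooth section `b` of the source map such that `tgt ∘ b` is a diffeomorphism
of the base. The diffeomorphism `base` is recorded as data, but is determined by `b`. -/
structure Bisection (𝒢 : LieGroupoid EG EM G M) where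
  toFun : M → G
  smooth_toFun : ContMDiff 𝓘(ℝ, EM) 𝓘(ℝ, EG) ∞ toFun
  src_toFun : ∀ m, 𝒢.src (toFun m) = m
  base : M ≃ₘ⟮𝓘(ℝ, EM), 𝓘(ℝ, EM)⟯ M
  tgt_toFun : ∀ m, 𝒢.tgt (toFun m) = base m

namespace Bisection

variable {𝒢 : LieGroupoid EG EM G M}

theorem ext' {b b' : Bisection 𝒢} (h : ∀ m, b.toFun m = b'.toFun m) : b = b' := by
  cases b with | mk f sf hf d hd =>
  cases b' with | mk f' sf' hf' d' hd' =>
  obtain rfl : f = f' := funext h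
  obtain rfl : d = d' := Diffeomorph.ext fun m => (hd m).symm.trans (hd' m)
  rfl

/-- `(b₁ · b₂)(m) = b₁((tgt ∘ b₂)(m)) b₂(m)`. -/
instance : Mul (Bisection 𝒢) where
  mul b₁ b₂ :=
    { toFun := fun m => 𝒢.comp (b₁.toFun (b₂.base m)) (b₂.toFun m)
        ((b₁.src_toFun _).trans (b₂.tgt_toFun m).symm)
      smooth_toFun := 𝒢.smooth_comp.comp_contMDiff
        (h := fun m => (b₁.toFun (b₂.base m), b₂.toFun m))
        ((b₁.smooth_toFun.comp b₂.base.contMDiff).prodMk b₂.smooth_toFun)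
        (fun m => (b₁.src_toFun _).trans (b₂.tgt_toFun m).symm)
      src_toFun := fun m => (𝒢.src_comp _ _ _).trans (b₂.src_toFun m)
      base := b₂.base.trans b₁.base
      tgt_toFun := fun m => (𝒢.tgt_comp _ _ _).trans (b₁.tgt_toFun _) }

/-- The bisection of units. -/
instance : One (Bisection 𝒢) where
  one :=
    { toFun := 𝒢.unit
      smooth_toFun := 𝒢.smooth_unit
      src_toFun := 𝒢.src_unit
      base := Diffeomorph.refl _ M ∞
      tgt_toFun := 𝒢.tgt_unit }

instance : Inv (Bisection 𝒢) where
  inv b :=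
    { toFun := fun m => 𝒢.inv (b.toFun (b.base.symm m))
      smooth_toFun := 𝒢.smooth_inv.comp (b.smooth_toFun.comp b.base.symm.contMDiff)
      src_toFun := fun m => by
        rw [𝒢.src_inv, b.tgt_toFun, b.base.apply_symm_apply]
      base := b.base.symm
      tgt_toFun := fun m => by rw [𝒢.tgt_inv, b.src_toFun] }

/-- The group of bisections. -/
instance : Group (Bisection 𝒢) :=
  Group.ofLeftAxioms
    (fun b₁ b₂ b₃ => ext' fun m => 𝒢.comp_assoc _ _ _ _ _)
    (fun b => ext' fun _ => (𝒢.comp_congr (by rw [b.tgt_toFun]; rfl) rfl _).trans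
      (𝒢.unit_comp (b.toFun _)))
    (fun b => ext' fun m => by
      refine (𝒢.comp_congr (a' := 𝒢.inv (b.toFun m)) (b' := b.toFun m) ?_ rfl _).trans ?_
      · change 𝒢.inv (b.toFun (b.base.symm (b.base m))) = _
        rw [b.base.symm_apply_apply]
      · rw [𝒢.inv_comp, b.src_toFun]; rfl)

end Bisection

/-! ### Actions on fibered manifolds and the action groupoid -/

variable {EF : Type*} [NormedAddCommGroup EF] [NormedSpace ℝ EF]
  {F : Type*} [TopologicalSpace F] [ChartedSpace EF F]

variable (EF EM) in
/-- A fibered manifold is a surjective submersion. -/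
structure IsFiberedManifold (φ : F → M) : Prop where
  surjective : Function.Surjective φ
  submersion : Manifold.IsSubmersion 𝓘(ℝ, EF) 𝓘(ℝ, EM) ∞ φ

/-- The pullback `φ^*G = G ×_M F`, along the source map. -/
def LieGroupoid.pullback (𝒢 : LieGroupoid EG EM G M) (φ : F → M) : Set (G × F) :=
  {x | φ x.2 = 𝒢.src x.1}

variable (EF) in
/-- An action of a Lie groupoid on `φ : F → M`: every arrow `g` gives a bijection from the fibre
over its source to the fibre over its target, compatibly with products, and `(g, p) ↦ S(g)(p)` is
smooth on `φ^*G` (which contains the smoothness of each `S(g)` on its fibre). -/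
structure GroupoidAction (𝒢 : LieGroupoid EG EM G M) (φ : F → M) where
  act : ∀ g : G, {p : F // φ p = 𝒢.src g} ≃ {p : F // φ p = 𝒢.tgt g}
  act_comp : ∀ (g₂ g₁ : G) (h : 𝒢.src g₂ = 𝒢.tgt g₁) (p : F) (hp : φ p = 𝒢.src g₁),
    (act (𝒢.comp g₂ g₁ h) ⟨p, hp.trans (𝒢.src_comp g₂ g₁ h).symm⟩ : F) =
      act g₂ ⟨act g₁ ⟨p, hp⟩, (act g₁ ⟨p, hp⟩).2.trans h.symm⟩
  smooth_act : SmoothOnSubset (𝓘(ℝ, EG).prod 𝓘(ℝ, EF)) 𝓘(ℝ, EF) (𝒢.pullback φ)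
    (fun x => (act x.1.1 ⟨x.1.2, x.2⟩ : F))

namespace GroupoidAction

variable {𝒢 : LieGroupoid EG EM G M} {φ : F → M} (S : GroupoidAction EF 𝒢 φ)

theorem act_congr {g g' : G} (hg : g = g') {p p' : F} (hp : p = p') (h : φ p = 𝒢.src g) :
    (S.act g ⟨p, h⟩ : F) = S.act g' ⟨p', by rw [← hg, ← hp]; exact h⟩ := by
  subst hg hp; rfl

theorem act_unit (m : M) (p : F) (h : φ p = 𝒢.src (𝒢.unit m)) :
    (S.act (𝒢.unit m) ⟨p, h⟩ : F) = p := by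
  have hu : 𝒢.src (𝒢.unit m) = 𝒢.tgt (𝒢.unit m) := by rw [𝒢.src_unit, 𝒢.tgt_unit]
  have hc : 𝒢.comp (𝒢.unit m) (𝒢.unit m) hu = 𝒢.unit m :=
    (𝒢.comp_congr rfl (by rw [𝒢.src_unit]) hu).trans (𝒢.comp_unit (𝒢.unit m))
  have h1 := S.act_comp (𝒢.unit m) (𝒢.unit m) hu p h
  rw [S.act_congr hc rfl] at h1
  have h2 := (S.act (𝒢.unit m)).injective (Subtype.ext h1)
  exact (congrArg Subtype.val h2).symm

/-- The action groupoid: arrows `(g, p) ∈ φ^*G` from `p` to `S(g)(p)`, with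
`(g₂, S(g₁)(p)) (g₁, p) = (g₂ g₁, p)`. -/
def actionGroupoid : GroupoidOver (𝒢.pullback φ) F where
  src x := x.1.2
  tgt x := S.act x.1.1 ⟨x.1.2, x.2⟩
  unit p := ⟨(𝒢.unit (φ p), p), (𝒢.src_unit _).symm⟩
  inv x := ⟨(𝒢.inv x.1.1, S.act x.1.1 ⟨x.1.2, x.2⟩),
    (S.act x.1.1 ⟨x.1.2, x.2⟩).2.trans (𝒢.src_inv _).symm⟩
  comp x y h := ⟨(𝒢.comp x.1.1 y.1.1
      (x.2.symm.trans ((congrArg φ h).trans (S.act y.1.1 ⟨y.1.2, y.2⟩).2)), y.1.2),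
    (show φ y.1.2 = _ from y.2).trans (𝒢.src_comp _ _ _).symm⟩
  src_comp _ _ _ := rfl
  tgt_comp x y h := by
    rw [S.act_comp _ _ _ _ y.2]
    exact S.act_congr rfl h.symm _
  src_unit _ := rfl
  tgt_unit p := S.act_unit _ _ _
  src_inv _ := rfl
  tgt_inv x := by
    have h1 := S.act_comp (𝒢.inv x.1.1) x.1.1 (𝒢.src_inv _) x.1.2 x.2
    rw [← h1, S.act_congr (𝒢.inv_comp _) rfl]
    exact S.act_unit _ _ _
  comp_assoc x y z h h' := Subtype.ext (Prod.ext (𝒢.comp_assoc _ _ _ _ _) rfl)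
  unit_comp x := by
    refine Subtype.ext (Prod.ext ?_ rfl)
    refine (𝒢.comp_congr (congrArg 𝒢.unit (S.act x.1.1 ⟨x.1.2, x.2⟩).2) rfl _).trans ?_
    exact 𝒢.unit_comp _
  comp_unit x := by
    refine Subtype.ext (Prod.ext ?_ rfl)
    exact (𝒢.comp_congr rfl (congrArg 𝒢.unit x.2) _).trans (𝒢.comp_unit _)
  inv_comp x := Subtype.ext (Prod.ext
    ((𝒢.inv_comp _).trans (congrArg 𝒢.unit (show φ x.1.2 = _ from x.2).symm)) rfl)
  comp_inv x := Subtype.ext (Prod.ext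
    ((𝒢.comp_inv _).trans (congrArg 𝒢.unit (S.act x.1.1 ⟨x.1.2, x.2⟩).2.symm)) rfl)

/-- The arrow `(b(φ(p)), p)` of the action groupoid attached to a bisection `b` and a point `p`. -/
def bisectionArrow (_S : GroupoidAction EF 𝒢 φ) (b : Bisection 𝒢) (p : F) : 𝒢.pullback φ :=
  ⟨(b.toFun (φ p), p), (b.src_toFun _).symm⟩

end GroupoidAction

end Lie

/-! ### The groupoid of isomorphisms between fibres of a vector bundle, and representations -/

section VB

variable {EF : Type*} [NormedAddCommGroup EF] [NormedSpace ℝ EF]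
  {F : Type*} [TopologicalSpace F] [ChartedSpace EF F]
  (V : Type*) [NormedAddCommGroup V] [NormedSpace ℝ V]
  (E : F → Type*) [∀ p, AddCommGroup (E p)] [∀ p, Module ℝ (E p)] [∀ p, TopologicalSpace (E p)]

/-- An element of `Φ(E)`: a linear isomorphism from one fibre of `E` to another. (For bundles of
finite rank, continuity is automatic.) -/
structure FrameArrow where
  src : F
  tgt : F
  map : E src ≃L[ℝ] E tgt

namespace FrameArrow

variable {E}

/-- The identification of fibres over equal points. -/
def fiberCast {p q : F} (h : p = q) : E p ≃L[ℝ] E q := h ▸ ContinuousLinearEquiv.refl ℝ (E p)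

/-- Composition of isomorphisms between fibres. -/
def comp (a b : FrameArrow E) (h : a.src = b.tgt) : FrameArrow E :=
  ⟨b.src, a.tgt, (b.map.trans (fiberCast h.symm)).trans a.map⟩

end FrameArrow

/-- The groupoid `Φ(E)` with its composition of maps. -/
def frameGroupoid : GroupoidOver (FrameArrow E) F where
  src := FrameArrow.src
  tgt := FrameArrow.tgt
  unit p := ⟨p, p, ContinuousLinearEquiv.refl ℝ (E p)⟩
  inv a := ⟨a.tgt, a.src, a.map.symm⟩
  comp := FrameArrow.comp
  src_comp _ _ _ := rfl
  tgt_comp _ _ _ := rfl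
  src_unit _ := rfl
  tgt_unit _ := rfl
  src_inv _ := rfl
  tgt_inv _ := rfl
  comp_assoc := by
    rintro ⟨p, q, a⟩ ⟨p', q', b⟩ ⟨p'', q'', c⟩ h h'
    dsimp only at h h'
    subst h h'
    rfl
  unit_comp _ := rfl
  comp_unit _ := rfl
  inv_comp := by
    rintro ⟨p, q, a⟩
    exact congrArg (FrameArrow.mk p p) (ContinuousLinearEquiv.ext (funext a.symm_apply_apply))
  comp_inv := by
    rintro ⟨p, q, a⟩
    exact congrArg (FrameArrow.mk q q) (ContinuousLinearEquiv.ext (funext a.apply_symm_apply))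

variable [TopologicalSpace (TotalSpace V E)] [FiberBundle V E] [VectorBundle ℝ V E]

variable {E} in
variable (EF) in
/-- Smoothness of a map `f : s → Φ(E)`, where `s` is a subset of a manifold `X`, for the smooth
structure of `Φ(E)` that locally identifies `Φ(F × V)` with `F × GL(V) × F`: source and target are
smooth, and so is the matrix of `f` in any two local trivializations of `E`, where it is defined. -/
structure SmoothToFrame {HX : Type*} [TopologicalSpace HX] {EX : Type*}
    [NormedAddCommGroup EX] [NormedSpace ℝ EX] {X : Type*} [TopologicalSpace X] [ChartedSpace HX X]
    (I : ModelWithCorners ℝ EX HX) (s : Set X) (f : s → FrameArrow E) : Prop where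
  src : SmoothOnSubset I 𝓘(ℝ, EF) s (fun x => (f x).src)
  tgt : SmoothOnSubset I 𝓘(ℝ, EF) s (fun x => (f x).tgt)
  map : ∀ p q : F, SmoothOnSubset I 𝓘(ℝ, V →L[ℝ] V)
    {x : X | ∃ h : x ∈ s, (f ⟨x, h⟩).src ∈ (trivializationAt V E p).baseSet ∧
      (f ⟨x, h⟩).tgt ∈ (trivializationAt V E q).baseSet}
    (fun x => ContinuousLinearMap.inCoordinates V E V E
      p (f ⟨x.1, x.2.1⟩).src q (f ⟨x.1, x.2.1⟩).tgt
      ((f ⟨x.1, x.2.1⟩).map : E (f ⟨x.1, x.2.1⟩).src →L[ℝ] E (f ⟨x.1, x.2.1⟩).tgt))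

/-- A representation of the action groupoid on the vector bundle `E` with base `F`: a
base-preserving morphism of Lie groupoids from the action groupoid to `Φ(E)`. -/
structure ActionGroupoidRep {EG EM : Type*} [NormedAddCommGroup EG] [NormedSpace ℝ EG]
    [NormedAddCommGroup EM] [NormedSpace ℝ EM]
    {G M : Type*} [TopologicalSpace G] [ChartedSpace EG G] [TopologicalSpace M] [ChartedSpace EM M]
    {𝒢 : LieGroupoid EG EM G M} {φ : F → M} (S : GroupoidAction EF 𝒢 φ)
    extends GroupoidOver.Hom S.actionGroupoid (frameGroupoid E) where
  smooth_toFun : SmoothToFrame EF V (𝓘(ℝ, EG).prod 𝓘(ℝ, EF)) (𝒢.pullback φ) toFun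

/-! ### Semi-linear isomorphisms of the space of sections -/

variable (EF) in
/-- The space `ΓE` of smooth sections. -/
abbrev SmoothSections := ContMDiffSection 𝓘(ℝ, EF) V ∞ E

variable (EF F) in
/-- The algebra of smooth real-valued functions. -/
abbrev SmoothFunctions := C^∞⟮𝓘(ℝ, EF), F; 𝓘(ℝ), ℝ⟯

variable {V E} in
/-- The product `f ψ` of a smooth function and a section. -/
def fnSmul [ContMDiffVectorBundle ∞ V E 𝓘(ℝ, EF)]
    (f : SmoothFunctions EF F) (ψ : SmoothSections EF V E) : SmoothSections EF V E :=
  ⟨fun p => f p • ψ p, f.contMDiff.smul_section ψ.contMDiff⟩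

variable (EF) in
/-- The group (under composition) of semi-linear isomorphisms of `ΓE`: the `ℝ`-linear automorphisms
`μ` for which there is an `ℝ`-linear automorphism `μF` of the space of smooth functions
with `μ (f ψ) = μF f · μ ψ`. -/
def semilinearIso [ContMDiffVectorBundle ∞ V E 𝓘(ℝ, EF)] :
    Subgroup (SmoothSections EF V E ≃ₗ[ℝ] SmoothSections EF V E) where
  carrier := {μ | ∃ μF : SmoothFunctions EF F ≃ₗ[ℝ] SmoothFunctions EF F,
    ∀ f ψ, μ (fnSmul f ψ) = fnSmul (μF f) (μ ψ)}
  mul_mem' := by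
    rintro μ ν ⟨a, ha⟩ ⟨b, hb⟩
    exact ⟨a * b, fun f ψ => by simp [LinearEquiv.mul_apply, ha, hb]⟩
  one_mem' := ⟨1, fun _ _ => rfl⟩
  inv_mem' := by
    rintro μ ⟨a, ha⟩
    refine ⟨a⁻¹, fun f ψ => ?_⟩
    apply μ.injective
    rw [ha]
    change μ (μ.symm _) = fnSmul (a (a.symm f)) (μ (μ.symm ψ))
    simp

/-! ### Vector bundle automorphisms -/

variable (EF) in
/-- An automorphism of the vector bundle `E`, over the diffeomorphism `base` of `F`. -/
structure VectorBundleAut where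
  total : TotalSpace V E ≃ₘ⟮𝓘(ℝ, EF).prod 𝓘(ℝ, V), 𝓘(ℝ, EF).prod 𝓘(ℝ, V)⟯ TotalSpace V E
  base : F ≃ₘ⟮𝓘(ℝ, EF), 𝓘(ℝ, EF)⟯ F
  linear : ∀ p : F, ∃ ℓ : E p ≃ₗ[ℝ] E (base p), ∀ v : E p, total ⟨p, v⟩ = ⟨base p, ℓ v⟩

end VB

end

/-! A bisection `b` of `G` lifts to the family of arrows `(b(φ p), p)` of the action groupoid. Since
`b_F` covers `β ∘ b`, lifting respects products: the arrow of `b₁ * b₂` at `p` is the arrow of `b₁`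
at `(b₂)_F p` times the arrow of `b₂` at `p` (`bisectionArrow_mul`). Applying the target map and `ρ`
to this identity makes `b ↦ b_F` and `b ↦ ν_b` multiplicative, and both send `1` to the identity.
The inverses of `b_F` and `ν_b` therefore come from `b⁻¹`, so smoothness only has to be proved in
the forward direction: for `b_F` it is that of the action, for `ν_b` that of the matrices of `ρ` in
local trivializations (`contMDiff_bisectionTotal`).

Any vector bundle automorphism acts semi-linearly on sections by `ψ ↦ ν ∘ ψ ∘ base⁻¹`
(`pushforward_fnSmul`), and multiplicativity of `ν_b` passes to this action
(`pushforward_bisectionAut_mul`). -/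

noncomputable section

/-! ### Composition with maps that are smooth on a subset -/

section LocalComposition

variable {HX : Type*} [TopologicalSpace HX] {EX : Type*} [NormedAddCommGroup EX] [NormedSpace ℝ EX]
  {HN : Type*} [TopologicalSpace HN] {EN : Type*} [NormedAddCommGroup EN] [NormedSpace ℝ EN]
  {HY : Type*} [TopologicalSpace HY] {EY : Type*} [NormedAddCommGroup EY] [NormedSpace ℝ EY]
  {X : Type*} [TopologicalSpace X] [ChartedSpace HX X]
  {N : Type*} [TopologicalSpace N] [ChartedSpace HN N]
  {Y : Type*} [TopologicalSpace Y] [ChartedSpace HY Y]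
  {I : ModelWithCorners ℝ EX HX} {J : ModelWithCorners ℝ EN HN} {K : ModelWithCorners ℝ EY HY}

/-- Smoothness is local, so `h` need only land in `s` near `y`. This is the form needed for matrices
of `ρ`, whose smoothness is given only where both endpoints lie in chosen trivializations. -/
theorem SmoothOnSubset.comp_contMDiffAt {s : Set X} {f : s → N} (hf : SmoothOnSubset I J s f)
    {h : Y → X} {k : Y → N} {y : Y} (hh : ContMDiffAt K I ∞ h y) (hs : ∀ᶠ z in nhds y, h z ∈ s)
    (hk : ∀ z (hz : h z ∈ s), k z = f ⟨h z, hz⟩) : ContMDiffAt K J ∞ k y := by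
  obtain ⟨U, hU, hyU, g, hg, hgf⟩ := hf ⟨h y, hs.self_of_nhds⟩
  have h1 : ContMDiffAt K J ∞ (fun y => g (h y)) y :=
    (hg.contMDiffAt (hU.mem_nhds hyU)).comp y hh
  refine h1.congr_of_eventuallyEq ?_
  filter_upwards [hh.continuousAt.preimage_mem_nhds (hU.mem_nhds hyU), hs] with z hz hzs
  exact (hk z hzs).trans (hgf _ hzs hz).symm

end LocalComposition

/-! ### The diffeomorphism of `F` induced by a bisection -/

section BaseMap

variable {EG EM EF : Type*} [NormedAddCommGroup EG] [NormedSpace ℝ EG]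
  [NormedAddCommGroup EM] [NormedSpace ℝ EM] [NormedAddCommGroup EF] [NormedSpace ℝ EF]
  {G M F : Type*} [TopologicalSpace G] [ChartedSpace EG G] [TopologicalSpace M] [ChartedSpace EM M]
  [TopologicalSpace F] [ChartedSpace EF F]
  {𝒢 : LieGroupoid EG EM G M} {φ : F → M} (S : GroupoidAction EF 𝒢 φ)

namespace GroupoidAction

/-- The map `p ↦ S(b(φ p))(p)` of `F` induced by a bisection `b`. -/
def bisectionMap (b : Bisection 𝒢) (p : F) : F :=
  S.actionGroupoid.tgt (S.bisectionArrow b p)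

theorem proj_bisectionMap (b : Bisection 𝒢) (p : F) : φ (S.bisectionMap b p) = b.base (φ p) :=
  (S.act (b.toFun (φ p)) ⟨p, (b.src_toFun _).symm⟩).2.trans (b.tgt_toFun _)

/-- The product in `𝓑(G)` evaluates `b₁` at `(β ∘ b₂)(φ p)`, the lifted arrow at `φ((b₂)_F p)`;
`proj_bisectionMap` identifies these points. -/
theorem bisectionArrow_mul (b₁ b₂ : Bisection 𝒢) (p : F) :
    S.bisectionArrow (b₁ * b₂) p = S.actionGroupoid.comp (S.bisectionArrow b₁ (S.bisectionMap b₂ p))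
      (S.bisectionArrow b₂ p) rfl :=
  Subtype.ext (Prod.ext
    (𝒢.comp_congr (congrArg b₁.toFun (S.proj_bisectionMap b₂ p).symm) rfl _) rfl)

theorem bisectionMap_mul (b₁ b₂ : Bisection 𝒢) (p : F) :
    S.bisectionMap (b₁ * b₂) p = S.bisectionMap b₁ (S.bisectionMap b₂ p) :=
  (congrArg S.actionGroupoid.tgt (S.bisectionArrow_mul b₁ b₂ p)).trans
    (S.actionGroupoid.tgt_comp _ _ _)

theorem bisectionMap_one (p : F) : S.bisectionMap 1 p = p :=
  S.act_unit (φ p) p _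

theorem contMDiff_bisectionArrow (hφ : ContMDiff 𝓘(ℝ, EF) 𝓘(ℝ, EM) ∞ φ) (b : Bisection 𝒢) :
    ContMDiff 𝓘(ℝ, EF) (𝓘(ℝ, EG).prod 𝓘(ℝ, EF)) ∞
      (fun p => (S.bisectionArrow b p : G × F)) :=
  (b.smooth_toFun.comp hφ).prodMk contMDiff_id

theorem contMDiff_bisectionMap (hφ : ContMDiff 𝓘(ℝ, EF) 𝓘(ℝ, EM) ∞ φ) (b : Bisection 𝒢) :
    ContMDiff 𝓘(ℝ, EF) 𝓘(ℝ, EF) ∞ (S.bisectionMap b) :=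
  S.smooth_act.comp_contMDiff (S.contMDiff_bisectionArrow hφ b) (fun p => (S.bisectionArrow b p).2)

/-- The diffeomorphism `p ↦ S(b(φ p))(p)` of `F` induced by a bisection `b`. -/
def bisectionDiffeo (hφ : ContMDiff 𝓘(ℝ, EF) 𝓘(ℝ, EM) ∞ φ) (b : Bisection 𝒢) :
    F ≃ₘ⟮𝓘(ℝ, EF), 𝓘(ℝ, EF)⟯ F where
  toFun := S.bisectionMap b
  -- With the inverse taken from `b⁻¹`, its smoothness is another instance of the forward statement.
  invFun := S.bisectionMap b⁻¹
  left_inv p := by rw [← bisectionMap_mul, inv_mul_cancel, bisectionMap_one]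
  right_inv p := by rw [← bisectionMap_mul, mul_inv_cancel, bisectionMap_one]
  contMDiff_toFun := S.contMDiff_bisectionMap hφ b
  contMDiff_invFun := S.contMDiff_bisectionMap hφ b⁻¹

end GroupoidAction

end BaseMap

/-! ### Isomorphisms between fibres acting on the total space -/

section TotalMap

variable {F : Type*} {V : Type*} {E : F → Type*}
  [∀ p, AddCommGroup (E p)] [∀ p, Module ℝ (E p)] [∀ p, TopologicalSpace (E p)]

namespace FrameArrow

/-- Fibres over provably equal points are different types, but the transport between them is
invisible in the total space; identities between vectors are therefore stated there. -/
theorem mk_fiberCast {p q : F} (h : p = q) (v : E p) :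
    (⟨q, fiberCast h v⟩ : TotalSpace V E) = ⟨p, v⟩ := by
  subst h; rfl

/-- The action of an isomorphism between fibres on a vector in its source fibre. -/
def mapTotal (a : FrameArrow E) (x : TotalSpace V E) (h : a.src = x.proj) : TotalSpace V E :=
  ⟨a.tgt, a.map (fiberCast h.symm x.snd)⟩

theorem mapTotal_comp (a b : FrameArrow E) (h : a.src = b.tgt) (x : TotalSpace V E)
    (hx : b.src = x.proj) :
    (comp a b h).mapTotal x hx = a.mapTotal (b.mapTotal x hx) h := by
  obtain ⟨p, q, a⟩ := a
  obtain ⟨p', q', b⟩ := b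
  obtain ⟨p'', v⟩ := x
  dsimp only at h hx
  subst h hx
  rfl

theorem mapTotal_congr {a a' : FrameArrow E} (ha : a = a') {x x' : TotalSpace V E} (hx : x = x')
    (h : a.src = x.proj) : a.mapTotal x h = a'.mapTotal x' (by rw [← ha, ← hx]; exact h) := by
  subst ha hx; rfl

theorem mapTotal_injective (a : FrameArrow E) {x x' : TotalSpace V E} (h : a.src = x.proj)
    (h' : a.src = x'.proj) (hxx' : a.mapTotal x h = a.mapTotal x' h') : x = x' := by
  obtain ⟨p, q, a⟩ := a
  obtain ⟨p', v⟩ := x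
  obtain ⟨p'', v'⟩ := x'
  dsimp only at h h'
  subst h h'
  exact congrArg (TotalSpace.mk p) (a.injective (TotalSpace.mk_injective q hxx'))

/-- The endpoints are free variables so that they can be substituted: the endpoints of `ρ(g, p)` are
known only up to a proved equality. -/
theorem exists_linearEquiv (a : FrameArrow E) {p q : F} (hp : a.src = p) (hq : a.tgt = q) :
    ∃ ℓ : E p ≃ₗ[ℝ] E q, ∀ v : E p, a.mapTotal (⟨p, v⟩ : TotalSpace V E) hp = ⟨q, ℓ v⟩ := by
  subst hp hq
  exact ⟨a.map.toLinearEquiv, fun _ => rfl⟩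

end FrameArrow

end TotalMap

/-! ### The vector bundle automorphism induced by a bisection -/

section Representation

variable {EG EM EF V : Type*} [NormedAddCommGroup EG] [NormedSpace ℝ EG]
  [NormedAddCommGroup EM] [NormedSpace ℝ EM] [NormedAddCommGroup EF] [NormedSpace ℝ EF]
  [NormedAddCommGroup V] [NormedSpace ℝ V]
  {G M F : Type*} [TopologicalSpace G] [ChartedSpace EG G] [TopologicalSpace M] [ChartedSpace EM M]
  [TopologicalSpace F] [ChartedSpace EF F]
  {𝒢 : LieGroupoid EG EM G M} {φ : F → M} {S : GroupoidAction EF 𝒢 φ}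
  {E : F → Type*} [∀ p, AddCommGroup (E p)] [∀ p, Module ℝ (E p)] [∀ p, TopologicalSpace (E p)]
  [TopologicalSpace (TotalSpace V E)] [FiberBundle V E] [VectorBundle ℝ V E]

namespace ActionGroupoidRep

variable (ρ : ActionGroupoidRep V E S)

/-- The map `v ↦ ρ(b(φ p), p)(v)`, for `v ∈ E_p`, of the total space of `E` induced by a
bisection `b`. -/
def bisectionTotal (b : Bisection 𝒢) (x : TotalSpace V E) : TotalSpace V E :=
  (ρ.toFun (S.bisectionArrow b x.proj)).mapTotal x (ρ.src_toFun _)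

theorem proj_bisectionTotal (b : Bisection 𝒢) (x : TotalSpace V E) :
    (ρ.bisectionTotal b x).proj = S.bisectionMap b x.proj :=
  ρ.tgt_toFun _

theorem bisectionTotal_mul (b₁ b₂ : Bisection 𝒢) (x : TotalSpace V E) :
    ρ.bisectionTotal (b₁ * b₂) x = ρ.bisectionTotal b₁ (ρ.bisectionTotal b₂ x) := by
  have h : ρ.toFun (S.bisectionArrow (b₁ * b₂) x.proj) = _ :=
    (congrArg ρ.toFun (S.bisectionArrow_mul b₁ b₂ x.proj)).trans (ρ.toFun_comp _ _ _)
  refine (FrameArrow.mapTotal_congr h rfl _).trans ?_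
  refine (FrameArrow.mapTotal_comp (ρ.toFun (S.bisectionArrow b₁ (S.bisectionMap b₂ x.proj)))
    (ρ.toFun (S.bisectionArrow b₂ x.proj))
    ((ρ.src_toFun _).trans (ρ.proj_bisectionTotal b₂ x).symm) x (ρ.src_toFun _)).trans ?_
  refine FrameArrow.mapTotal_congr ?_ rfl _
  exact congrArg (fun p => ρ.toFun (S.bisectionArrow b₁ p)) (ρ.proj_bisectionTotal b₂ x).symm

/-- `GroupoidOver.Hom` does not postulate preservation of units. Instead `ν_1` is idempotent, by
multiplicativity, and injective on each fibre, hence the identity. -/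
theorem bisectionTotal_one (x : TotalSpace V E) : ρ.bisectionTotal 1 x = x := by
  have hp : (ρ.bisectionTotal 1 x).proj = x.proj :=
    (ρ.proj_bisectionTotal 1 x).trans (S.bisectionMap_one _)
  have h := ρ.bisectionTotal_mul 1 1 x
  rw [mul_one] at h
  refine FrameArrow.mapTotal_injective (ρ.toFun (S.bisectionArrow 1 x.proj))
    ((ρ.src_toFun _).trans hp.symm) (ρ.src_toFun _) ?_
  refine (FrameArrow.mapTotal_congr ?_ rfl _).trans h.symm
  exact congrArg (fun p => ρ.toFun (S.bisectionArrow 1 p)) hp.symm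

/-- In trivializations around the source and the target, `ν_b` applies a smoothly varying matrix to
a smoothly varying vector. -/
theorem contMDiff_bisectionTotal (hφ : ContMDiff 𝓘(ℝ, EF) 𝓘(ℝ, EM) ∞ φ) (b : Bisection 𝒢)
    [IsManifold 𝓘(ℝ, EF) ∞ F] [ContMDiffVectorBundle ∞ V E 𝓘(ℝ, EF)] :
    ContMDiff (𝓘(ℝ, EF).prod 𝓘(ℝ, V)) (𝓘(ℝ, EF).prod 𝓘(ℝ, V)) ∞ (ρ.bisectionTotal b) := by
  intro x₀
  have harrow : ContMDiff (𝓘(ℝ, EF).prod 𝓘(ℝ, V)) (𝓘(ℝ, EG).prod 𝓘(ℝ, EF)) ∞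
      (fun x : TotalSpace V E => (S.bisectionArrow b x.proj : G × F)) :=
    (S.contMDiff_bisectionArrow hφ b).comp (contMDiff_proj E)
  have hsrc : ContMDiff (𝓘(ℝ, EF).prod 𝓘(ℝ, V)) 𝓘(ℝ, EF) ∞
      (fun x : TotalSpace V E => (ρ.toFun (S.bisectionArrow b x.proj)).src) :=
    ρ.smooth_toFun.src.comp_contMDiff harrow fun x => (S.bisectionArrow b x.proj).2
  have htgt : ContMDiff (𝓘(ℝ, EF).prod 𝓘(ℝ, V)) 𝓘(ℝ, EF) ∞
      (fun x : TotalSpace V E => (ρ.toFun (S.bisectionArrow b x.proj)).tgt) :=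
    ρ.smooth_toFun.tgt.comp_contMDiff harrow fun x => (S.bisectionArrow b x.proj).2
  refine ContMDiffAt.clm_apply_of_inCoordinates (F₁ := V) (F₂ := V) (IB₁ := 𝓘(ℝ, EF))
    (IB₂ := 𝓘(ℝ, EF))
    (b₁ := fun x : TotalSpace V E => (ρ.toFun (S.bisectionArrow b x.proj)).src)
    (b₂ := fun x : TotalSpace V E => (ρ.toFun (S.bisectionArrow b x.proj)).tgt)
    (ϕ := fun x : TotalSpace V E => ((ρ.toFun (S.bisectionArrow b x.proj)).map :
      E (ρ.toFun (S.bisectionArrow b x.proj)).src →L[ℝ] E (ρ.toFun (S.bisectionArrow b x.proj)).tgt))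
    (v := fun x : TotalSpace V E => FrameArrow.fiberCast (ρ.src_toFun _).symm x.snd)
    ?_ ?_ htgt.contMDiffAt
  · refine (ρ.smooth_toFun.map _ _).comp_contMDiffAt harrow.contMDiffAt ?_ (fun _ _ => rfl)
    -- By continuity, both endpoints stay in the two base sets near `x₀`, which is where the matrix
    -- of `ρ` is known to be smooth.
    filter_upwards [hsrc.continuous.continuousAt.preimage_mem_nhds
        ((trivializationAt V E _).open_baseSet.mem_nhds
          (FiberBundle.mem_baseSet_trivializationAt' _)),
      htgt.continuous.continuousAt.preimage_mem_nhds
        ((trivializationAt V E _).open_baseSet.mem_nhds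
          (FiberBundle.mem_baseSet_trivializationAt' _))] with x hx hx'
    exact ⟨(S.bisectionArrow b x.proj).2, hx, hx'⟩
  -- Up to transport, the vector fed to the matrix is the point of the total space itself.
  · exact (contMDiffAt_id (I := 𝓘(ℝ, EF).prod 𝓘(ℝ, V)) (x := x₀)).congr_of_eventuallyEq
      (Filter.Eventually.of_forall fun x =>
        FrameArrow.mk_fiberCast (ρ.src_toFun (S.bisectionArrow b x.proj)).symm x.snd)

variable [IsManifold 𝓘(ℝ, EF) ∞ F] [ContMDiffVectorBundle ∞ V E 𝓘(ℝ, EF)]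

/-- The vector bundle automorphism induced by a bisection. -/
def bisectionAut (hφ : ContMDiff 𝓘(ℝ, EF) 𝓘(ℝ, EM) ∞ φ) (b : Bisection 𝒢) :
    VectorBundleAut EF V E where
  total :=
    { toFun := ρ.bisectionTotal b
      invFun := ρ.bisectionTotal b⁻¹
      left_inv := fun x => by rw [← bisectionTotal_mul, inv_mul_cancel, bisectionTotal_one]
      right_inv := fun x => by rw [← bisectionTotal_mul, mul_inv_cancel, bisectionTotal_one]
      contMDiff_toFun := ρ.contMDiff_bisectionTotal hφ b
      contMDiff_invFun := ρ.contMDiff_bisectionTotal hφ b⁻¹ }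
  base := S.bisectionDiffeo hφ b
  linear p := FrameArrow.exists_linearEquiv (ρ.toFun (S.bisectionArrow b p)) (ρ.src_toFun _)
    (ρ.tgt_toFun _)

end ActionGroupoidRep

end Representation

/-! ### Vector bundle automorphisms acting on sections -/

section Pushforward

variable {EF V : Type*} [NormedAddCommGroup EF] [NormedSpace ℝ EF]
  [NormedAddCommGroup V] [NormedSpace ℝ V]
  {F : Type*} [TopologicalSpace F] [ChartedSpace EF F]
  {E : F → Type*} [∀ p, AddCommGroup (E p)] [∀ p, Module ℝ (E p)] [∀ p, TopologicalSpace (E p)]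
  [TopologicalSpace (TotalSpace V E)] [FiberBundle V E]

namespace VectorBundleAut

variable (ν : VectorBundleAut EF V E)

theorem proj_total (x : TotalSpace V E) : (ν.total x).proj = ν.base x.proj := by
  obtain ⟨ℓ, hℓ⟩ := ν.linear x.proj
  exact congrArg TotalSpace.proj (hℓ x.snd)

/-- The section `ν ∘ ψ ∘ base⁻¹` associated to a section `ψ` by a vector bundle automorphism. -/
def pushforward (ψ : SmoothSections EF V E) : SmoothSections EF V E where
  toFun p := FrameArrow.fiberCast
    ((ν.proj_total ⟨ν.base.symm p, ψ _⟩).trans (ν.base.apply_symm_apply p))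
    (ν.total ⟨ν.base.symm p, ψ (ν.base.symm p)⟩).snd
  contMDiff_toFun := by
    have h := ν.total.contMDiff.comp (ψ.contMDiff.comp ν.base.symm.contMDiff)
    exact h.congr fun p => FrameArrow.mk_fiberCast _ _

theorem mk_pushforward (ψ : SmoothSections EF V E) (p : F) :
    (⟨p, ν.pushforward ψ p⟩ : TotalSpace V E) = ν.total ⟨ν.base.symm p, ψ (ν.base.symm p)⟩ :=
  FrameArrow.mk_fiberCast _ _

theorem mk_pushforward_base (ψ : SmoothSections EF V E) (p : F) :
    (⟨ν.base p, ν.pushforward ψ (ν.base p)⟩ : TotalSpace V E) = ν.total ⟨p, ψ p⟩ := by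
  rw [mk_pushforward, ν.base.symm_apply_apply]

/-- As `base` is onto, a section is determined by its values at the points `ν.base p`. Checking
identities there avoids both `base.symm` and transports. -/
theorem eq_pushforward {ψ χ : SmoothSections EF V E}
    (h : ∀ p, (⟨ν.base p, χ (ν.base p)⟩ : TotalSpace V E) = ν.total ⟨p, ψ p⟩) :
    χ = ν.pushforward ψ := by
  refine ContMDiffSection.ext fun q => ?_
  obtain ⟨p, rfl⟩ := ν.base.surjective q
  exact TotalSpace.mk_injective _ ((h p).trans (ν.mk_pushforward_base ψ p).symm)

theorem exists_linearEquiv_pushforward (p : F) : ∃ ℓ : E p ≃ₗ[ℝ] E (ν.base p),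
    (∀ v : E p, ν.total ⟨p, v⟩ = ⟨ν.base p, ℓ v⟩) ∧
      ∀ ψ : SmoothSections EF V E, ν.pushforward ψ (ν.base p) = ℓ (ψ p) := by
  obtain ⟨ℓ, hℓ⟩ := ν.linear p
  exact ⟨ℓ, hℓ, fun ψ => TotalSpace.mk_injective _ ((ν.mk_pushforward_base ψ p).trans (hℓ _))⟩

variable [VectorBundle ℝ V E]

theorem pushforward_add (ψ χ : SmoothSections EF V E) :
    ν.pushforward (ψ + χ) = ν.pushforward ψ + ν.pushforward χ := by
  refine (ν.eq_pushforward fun p => ?_).symm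
  obtain ⟨ℓ, hℓ, h⟩ := ν.exists_linearEquiv_pushforward p
  rw [hℓ, ContMDiffSection.coe_add, ContMDiffSection.coe_add, Pi.add_apply, Pi.add_apply, h, h,
    map_add]

theorem pushforward_smul (c : ℝ) (ψ : SmoothSections EF V E) :
    ν.pushforward (c • ψ) = c • ν.pushforward ψ := by
  refine (ν.eq_pushforward fun p => ?_).symm
  obtain ⟨ℓ, hℓ, h⟩ := ν.exists_linearEquiv_pushforward p
  rw [hℓ, ContMDiffSection.coe_smul, ContMDiffSection.coe_smul, Pi.smul_apply, Pi.smul_apply, h,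
    map_smul]

theorem pushforward_fnSmul [ContMDiffVectorBundle ∞ V E 𝓘(ℝ, EF)] (f : SmoothFunctions EF F)
    (ψ : SmoothSections EF V E) :
    ν.pushforward (fnSmul f ψ) =
      fnSmul (f.comp (ν.base.symm : C^∞⟮𝓘(ℝ, EF), F; 𝓘(ℝ, EF), F⟯)) (ν.pushforward ψ) := by
  refine (ν.eq_pushforward fun p => ?_).symm
  obtain ⟨ℓ, hℓ, h⟩ := ν.exists_linearEquiv_pushforward p
  rw [hℓ]
  change (⟨_, f (ν.base.symm (ν.base p)) • ν.pushforward ψ (ν.base p)⟩ : TotalSpace V E) =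
    ⟨_, ℓ (f p • ψ p)⟩
  rw [h, map_smul, ν.base.symm_apply_apply]

end VectorBundleAut

/-- Composition with the inverse of a diffeomorphism, as an automorphism of the space of smooth
functions. -/
def Diffeomorph.functionPushforward (d : F ≃ₘ⟮𝓘(ℝ, EF), 𝓘(ℝ, EF)⟯ F) :
    SmoothFunctions EF F ≃ₗ[ℝ] SmoothFunctions EF F where
  toFun f := f.comp (d.symm : C^∞⟮𝓘(ℝ, EF), F; 𝓘(ℝ, EF), F⟯)
  invFun f := f.comp (d : C^∞⟮𝓘(ℝ, EF), F; 𝓘(ℝ, EF), F⟯)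
  map_add' _ _ := rfl
  map_smul' _ _ := rfl
  left_inv f := ContMDiffMap.ext fun p => congrArg f (d.symm_apply_apply p)
  right_inv f := ContMDiffMap.ext fun p => congrArg f (d.apply_symm_apply p)

end Pushforward

/-! ### The homomorphism into semi-linear isomorphisms -/

section SectionRepresentation

variable {EG EM EF V : Type*} [NormedAddCommGroup EG] [NormedSpace ℝ EG]
  [NormedAddCommGroup EM] [NormedSpace ℝ EM] [NormedAddCommGroup EF] [NormedSpace ℝ EF]
  [NormedAddCommGroup V] [NormedSpace ℝ V]
  {G M F : Type*} [TopologicalSpace G] [ChartedSpace EG G] [TopologicalSpace M] [ChartedSpace EM M]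
  [TopologicalSpace F] [ChartedSpace EF F] [IsManifold 𝓘(ℝ, EF) ∞ F]
  {𝒢 : LieGroupoid EG EM G M} {φ : F → M} {S : GroupoidAction EF 𝒢 φ}
  {E : F → Type*} [∀ p, AddCommGroup (E p)] [∀ p, Module ℝ (E p)] [∀ p, TopologicalSpace (E p)]
  [TopologicalSpace (TotalSpace V E)] [FiberBundle V E] [VectorBundle ℝ V E]
  [ContMDiffVectorBundle ∞ V E 𝓘(ℝ, EF)]

namespace ActionGroupoidRep

variable (ρ : ActionGroupoidRep V E S) (hφ : ContMDiff 𝓘(ℝ, EF) 𝓘(ℝ, EM) ∞ φ)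

theorem pushforward_bisectionAut_mul (b₁ b₂ : Bisection 𝒢) (ψ : SmoothSections EF V E) :
    (ρ.bisectionAut hφ (b₁ * b₂)).pushforward ψ =
      (ρ.bisectionAut hφ b₁).pushforward ((ρ.bisectionAut hφ b₂).pushforward ψ) := by
  refine VectorBundleAut.eq_pushforward _ fun p => ?_
  -- Over the image of `p` under `(b₂)_F`, then `(b₁)_F`, both sides are values of `ν` on the vector
  -- `ψ p`.
  obtain ⟨p, rfl⟩ : ∃ q, (ρ.bisectionAut hφ b₂).base q = p :=
    (ρ.bisectionAut hφ b₂).base.surjective p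
  rw [VectorBundleAut.mk_pushforward_base]
  have hbase : (ρ.bisectionAut hφ b₁).base ((ρ.bisectionAut hφ b₂).base p) =
      (ρ.bisectionAut hφ (b₁ * b₂)).base p := (S.bisectionMap_mul b₁ b₂ p).symm
  rw [hbase, VectorBundleAut.mk_pushforward_base]
  exact ρ.bisectionTotal_mul b₁ b₂ _

theorem pushforward_bisectionAut_one (ψ : SmoothSections EF V E) :
    (ρ.bisectionAut hφ 1).pushforward ψ = ψ := by
  refine (VectorBundleAut.eq_pushforward _ fun p => ?_).symm
  have hbase : (ρ.bisectionAut hφ 1).base p = p := S.bisectionMap_one p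
  rw [hbase]
  exact (ρ.bisectionTotal_one _).symm

/-- The linear automorphism of the space of sections of `E` induced by a bisection. -/
def sectionEquiv (b : Bisection 𝒢) : SmoothSections EF V E ≃ₗ[ℝ] SmoothSections EF V E where
  toFun := (ρ.bisectionAut hφ b).pushforward
  invFun := (ρ.bisectionAut hφ b⁻¹).pushforward
  map_add' := VectorBundleAut.pushforward_add _
  map_smul' := VectorBundleAut.pushforward_smul _
  left_inv ψ := by
    rw [← pushforward_bisectionAut_mul, inv_mul_cancel, pushforward_bisectionAut_one]
  right_inv ψ := by
    rw [← pushforward_bisectionAut_mul, mul_inv_cancel, pushforward_bisectionAut_one]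

/-- The representation of the group of bisections by semi-linear isomorphisms of the space of
sections of `E`. -/
def sectionHom : Bisection 𝒢 →* semilinearIso EF V E :=
  MonoidHom.mk' (fun b => ⟨ρ.sectionEquiv hφ b, (ρ.bisectionAut hφ b).base.functionPushforward,
      (ρ.bisectionAut hφ b).pushforward_fnSmul⟩)
    fun b₁ b₂ => Subtype.ext (LinearEquiv.ext (ρ.pushforward_bisectionAut_mul hφ b₁ b₂))

end ActionGroupoidRep

end SectionRepresentation

end

theorem proposition5p5
    {EG EM EF V : Type*}
    [NormedAddCommGroup EG] [NormedSpace ℝ EG] [FiniteDimensional ℝ EG]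
    [NormedAddCommGroup EM] [NormedSpace ℝ EM] [FiniteDimensional ℝ EM]
    [NormedAddCommGroup EF] [NormedSpace ℝ EF] [FiniteDimensional ℝ EF]
    [NormedAddCommGroup V] [NormedSpace ℝ V] [FiniteDimensional ℝ V]
    -- the manifolds `G` (arrows), `M` (objects) and `F`
    {G M F : Type*}
    [TopologicalSpace G] [ChartedSpace EG G] [IsManifold 𝓘(ℝ, EG) ∞ G]
    [SecondCountableTopology G]
    [TopologicalSpace M] [ChartedSpace EM M] [IsManifold 𝓘(ℝ, EM) ∞ M]
    [T2Space M] [SecondCountableTopology M]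
    [TopologicalSpace F] [ChartedSpace EF F] [IsManifold 𝓘(ℝ, EF) ∞ F]
    [T2Space F] [SecondCountableTopology F]
    -- the Lie groupoid, and its action on the fibered manifold `φ : F → M`
    (𝒢 : LieGroupoid EG EM G M) (φ : F → M) (_hφ : IsFiberedManifold EM EF φ)
    (S : GroupoidAction EF 𝒢 φ)
    -- the smooth real vector bundle `E` over `F`, and the representation of the action groupoid
    (E : F → Type*) [∀ p, AddCommGroup (E p)] [∀ p, Module ℝ (E p)] [∀ p, TopologicalSpace (E p)]
    [TopologicalSpace (TotalSpace V E)] [FiberBundle V E] [VectorBundle ℝ V E]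
    [ContMDiffVectorBundle ∞ V E 𝓘(ℝ, EF)]
    (ρ : ActionGroupoidRep V E S) :
    ∃ R : Bisection 𝒢 →* semilinearIso EF V E, ∀ b : Bisection 𝒢,
      -- `R b` is given by a vector bundle automorphism `ν` over `p ↦ S(b(φ p))(p)`
      ∃ ν : VectorBundleAut EF V E,
        (∀ p : F, ν.base p = S.actionGroupoid.tgt (S.bisectionArrow b p)) ∧
        (∀ (p : F) (v : E (ρ.toFun (S.bisectionArrow b p)).src),
          ν.total ⟨_, v⟩ = ⟨_, (ρ.toFun (S.bisectionArrow b p)).map v⟩) ∧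
        (∀ (ψ : SmoothSections EF V E) (p : F),
          ν.total ⟨p, ψ p⟩ = ⟨ν.base p, (R b).1 ψ (ν.base p)⟩) ∧
        -- and is semi-linear with respect to the pullback of functions by the inverse of that map
        (∀ (f : SmoothFunctions EF F) (ψ : SmoothSections EF V E),
          (R b).1 (fnSmul f ψ) = fnSmul (f.comp ν.base.symm) ((R b).1 ψ)) := by
  have hφ : ContMDiff 𝓘(ℝ, EF) 𝓘(ℝ, EM) ∞ φ := _hφ.submersion.contMDiff
  refine ⟨ρ.sectionHom hφ, fun b => ⟨ρ.bisectionAut hφ b, fun _ => rfl, fun p v => ?_,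
    fun ψ p => ((ρ.bisectionAut hφ b).mk_pushforward_base ψ p).symm,
    (ρ.bisectionAut hφ b).pushforward_fnSmul⟩⟩
  -- The vector `v` lies over the source of `ρ(b(φ p), p)`, so `ν_b` uses the arrow at that source;
  -- it agrees with the arrow at `p`.
  have hp : (ρ.toFun (S.bisectionArrow b p)).src = p := ρ.src_toFun _
  exact FrameArrow.mapTotal_congr (x := ⟨_, v⟩)
    (congrArg (fun q => ρ.toFun (S.bisectionArrow b q)) hp) rfl (ρ.src_toFun (S.bisectionArrow b _))
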